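/- **Proposition (Maitre nonlinear compactness).** Let $T>0$ and let either $1\le p<\infty$, $r=1$, or $p=\infty$, $1<r\le\infty$. Let $X$, $B$ be Banach spaces and let $K:X\to B$ be a (possibly nonlinear) compact operator, i.e. $K$ maps bounded subsets of $X$ to relatively compact subsets of $B$. Let $(\tau_n)_{n\in\mathbb N}$ be a sequence of time steps $\tau_n>0$ with $T=N_n\tau_n$, $N_n\in\mathbb N$, and let $v_n\in L^1(0,T;X)$ be constant on each interval $((k-1)\tau_n,k\tau_n]$, $1\le k\le N_n$. Let $u_n=K(v_n)\in L^p(0,T;B)$. Assume that (i) $(v_n)$ is bounded in $L^1(0,T;X)$ and $(u_n)$ is bounded in $L^1(0,T;B)$; (ii) there exists $C>0$ such that for all $n$, $\|u_n(\cdot+\tau_n)-u_n\|_{L^r(0,T-\tau_n;B)}\le C\tau_n$. Then, if $p<\infty$, $(u_n)$ is relatively compact in $L^p(0,T;B)$. If $p=\infty$ and $\tau_n\to0$ as $n\to\infty$, there exist a subsequence of $(u_n)$ and a function $u\in C^0([0,T];B)$ such that this subsequence converges to $u$ in $L^q(0,T;B)$ for all $1\le q<\infty$. -/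

import Mathlib

open MeasureTheory Filter Topology Set
open scoped ENNReal

/-- A (possibly nonlinear) compact operator: the image of every bounded set is relatively
compact. Linearity is not required, nor is continuity. -/
def IsNonlinearCompact {X B : Type*} [NormedAddCommGroup X] [NormedAddCommGroup B]
    (K : X → B) : Prop :=
  ∀ S : Set X, Bornology.IsBounded S → IsCompact (closure (K '' S))

/-- `f` is constant on each of the intervals `((k - 1) * τ, k * τ]`, `1 ≤ k ≤ N`. -/
def IsPiecewiseConstInTime {E : Type*} (τ : ℝ) (N : ℕ) (f : ℝ → E) : Prop :=
  ∀ k : ℕ, 1 ≤ k → k ≤ N →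
    ∃ c : E, ∀ t ∈ Ioc (((k : ℝ) - 1) * τ) ((k : ℝ) * τ), f t = c

/-- Lebesgue measure on the open interval `(a, b)`. -/
noncomputable def timeMeasure (a b : ℝ) : Measure ℝ := volume.restrict (Ioo a b)

/-! Each `u n` is a step function with nodal values `a n k`, and its shifted difference has the
constant value `a n (k + 1) - a n k` on the k-th cell. With Hölder's inequality, (ii) bounds every
partial sum of increment norms by `C * length ^ (1 - 1/r)` (`sum_increments_le`): a uniform bound on
the variation if `r = 1`, a Hölder modulus up to the time step if `r > 1`.

Compactness of `K` enters through finite codes (`exists_finite_code`). On a grid of `M` cells, the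
`L^1` bound gives a time in each cell where `v n` is bounded; there `u n` lies in a fixed totally
bounded set, so finitely many patterns describe it up to `δ`. Functions with the same pattern nearly
agree somewhere in each cell, and the control of increments extends this to the whole cell.

For `r = 1` the cellwise errors are bounded and their sum is at most `2C + Mδ`, so the `L^p`
distance tends to 0 as the grid is refined. For `r > 1` and `τ n → 0` the error is uniformly small
for large `n`. Both cases give total boundedness, and completeness gives compactness. -/

lemma one_le_ceil_div {h t : ℝ} (hh : 0 < h) (ht : 0 < t) : 1 ≤ ⌈t / h⌉₊ :=
  Nat.one_le_ceil_iff.2 (div_pos ht hh)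

lemma ceil_div_le {h t : ℝ} {M : ℕ} (hh : 0 < h) (ht : t ≤ M * h) : ⌈t / h⌉₊ ≤ M :=
  Nat.ceil_le.2 ((div_le_iff₀ hh).2 ht)

lemma ceil_div_eq_of_mem {h t : ℝ} {k : ℕ} (hh : 0 < h)
    (ht : t ∈ Ioc ((k : ℝ) * h) (((k : ℝ) + 1) * h)) : ⌈t / h⌉₊ = k + 1 := by
  rw [Nat.ceil_eq_iff (by omega)]
  push_cast
  rw [lt_div_iff₀ hh, div_le_iff₀ hh]
  exact ht

lemma exists_cell {h t : ℝ} {M : ℕ} (hh : 0 < h) (ht : 0 < t) (htM : t ≤ M * h) :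
    ∃ j < M, t ∈ Ioc ((j : ℝ) * h) (((j : ℝ) + 1) * h) := by
  have h1 := one_le_ceil_div hh ht
  have h2 := ceil_div_le hh htM
  refine ⟨⌈t / h⌉₊ - 1, by omega, ?_, ?_⟩
  · rw [← lt_div_iff₀ hh]
    exact Nat.lt_ceil.1 (by omega)
  · rw [← div_le_iff₀ hh]
    have : ((⌈t / h⌉₊ - 1 : ℕ) : ℝ) + 1 = ⌈t / h⌉₊ := by
      rw [Nat.cast_sub h1]; push_cast; ring
    rw [this]
    exact Nat.le_ceil _

/-- A piecewise constant function is read off from its nodal values. -/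
lemma IsPiecewiseConstInTime.eq_nodal {E : Type*} {τ : ℝ} {N : ℕ} {f : ℝ → E}
    (hf : IsPiecewiseConstInTime τ N f) (hτ : 0 < τ) {t : ℝ} (ht : t ∈ Ioc 0 (N * τ)) :
    f t = f (⌈t / τ⌉₊ * τ) := by
  obtain ⟨j, hj, htj⟩ := exists_cell hτ ht.1 ht.2
  rw [ceil_div_eq_of_mem hτ htj]
  obtain ⟨c, hc⟩ := hf (j + 1) (by omega) (by omega)
  push_cast at hc ⊢
  rw [add_sub_cancel_right] at hc
  rw [hc t htj, hc _ ⟨by nlinarith, le_rfl⟩]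

lemma ceil_shift {τ t : ℝ} (hτ : 0 < τ) (ht : 0 < t) : ⌈(t + τ) / τ⌉₊ = ⌈t / τ⌉₊ + 1 := by
  rw [add_div, div_self hτ.ne', Nat.ceil_add_one (div_pos ht hτ).le]

/-! ### Increments, variation and modulus of continuity of step functions -/

/-- The increments of a step function are the time integral of its shifted difference. -/
lemma lintegral_shift_eq_sum {B : Type*} [NormedAddCommGroup B] (a : ℕ → B) {τ : ℝ} (hτ : 0 < τ)
    (i : ℕ) (n : ℕ) :
    ∫⁻ t in Ioc ((i : ℝ) * τ) (((i + n : ℕ) : ℝ) * τ), ‖a (⌈t / τ⌉₊ + 1) - a ⌈t / τ⌉₊‖ₑ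
      = ENNReal.ofReal (τ * ∑ k ∈ Finset.Ico (i + 1) (i + n + 1), ‖a (k + 1) - a k‖) := by
  induction n with
  | zero => simp
  | succ n ih =>
    have hu : Ioc ((i : ℝ) * τ) (((i + (n + 1) : ℕ) : ℝ) * τ)
        = Ioc ((i : ℝ) * τ) (((i + n : ℕ) : ℝ) * τ)
          ∪ Ioc (((i + n : ℕ) : ℝ) * τ) ((((i + n : ℕ) : ℝ) + 1) * τ) := by
      rw [Ioc_union_Ioc_eq_Ioc]
      · push_cast; ring_nf
      · push_cast; nlinarith [Nat.cast_nonneg (α := ℝ) n]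
      · nlinarith
    rw [hu, lintegral_union measurableSet_Ioc
      (Set.disjoint_left.2 fun x hx hy => (not_lt.2 hx.2) hy.1), ih]
    have hc : ∫⁻ t in Ioc (((i + n : ℕ) : ℝ) * τ) ((((i + n : ℕ) : ℝ) + 1) * τ),
        ‖a (⌈t / τ⌉₊ + 1) - a ⌈t / τ⌉₊‖ₑ
        = ∫⁻ t in Ioc (((i + n : ℕ) : ℝ) * τ) ((((i + n : ℕ) : ℝ) + 1) * τ),
          ‖a (i + n + 1 + 1) - a (i + n + 1)‖ₑ :=
      setLIntegral_congr_fun measurableSet_Ioc fun t ht => by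
        simp only [ceil_div_eq_of_mem hτ ht]
    rw [hc, setLIntegral_const, Real.volume_Ioc, ← ofReal_norm, ← ENNReal.ofReal_mul (norm_nonneg _),
      ← ENNReal.ofReal_add (by positivity) (mul_nonneg (norm_nonneg _) (by nlinarith)),
      show i + (n + 1) + 1 = (i + n + 1) + 1 by ring,
      Finset.sum_Ico_succ_top (show i + 1 ≤ i + n + 1 by omega)]
    congr 1
    ring

lemma timeMeasure_eq_Ioc (a b : ℝ) : timeMeasure a b = volume.restrict (Ioc a b) :=
  Measure.restrict_congr_set Ioo_ae_eq_Ioc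

/-- Hölder-type bound on the increments of a step function whose shifted difference is small
in `L^r`. -/
lemma sum_increments_le {B : Type*} [NormedAddCommGroup B] {a : ℕ → B} {u : ℝ → B} {τ T C : ℝ}
    {N : ℕ} {r : ℝ≥0∞} (hr : 1 ≤ r) (hτ : 0 < τ) (hT : T = N * τ) (hC : 0 ≤ C)
    (hu : ∀ t ∈ Ioc 0 T, u t = a ⌈t / τ⌉₊)
    (hshift : eLpNorm (fun t => u (t + τ) - u t) r (timeMeasure 0 (T - τ))
      ≤ ENNReal.ofReal (C * τ)) {i j : ℕ} (hi : 1 ≤ i) (hij : i ≤ j) (hj : j ≤ N) :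
    ∑ k ∈ Finset.Ico i j, ‖a (k + 1) - a k‖ ≤ C * (((j : ℝ) - i) * τ) ^ (1 - 1 / r.toReal) := by
  -- The k-th increment lives on `((k - 1)τ, kτ]`, so the sum fills `S`, which ends at least one
  -- step before `T`.
  obtain ⟨i, rfl⟩ : ∃ i', i = i' + 1 := ⟨i - 1, by omega⟩
  obtain ⟨n, rfl⟩ : ∃ n, j = i + n + 1 := ⟨j - (i + 1), by omega⟩
  set S : Set ℝ := Ioc ((i : ℝ) * τ) (((i + n : ℕ) : ℝ) * τ) with hS
  set g : ℝ → B := fun t => a (⌈t / τ⌉₊ + 1) - a ⌈t / τ⌉₊ with hg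
  have hjN : ((i + n + 1 : ℕ) : ℝ) * τ ≤ T := by
    rw [hT]; gcongr
  push_cast at hjN
  have hSsub : S ⊆ Ioc 0 (T - τ) := by
    intro t ht
    refine ⟨lt_of_le_of_lt (by positivity) ht.1, ht.2.trans ?_⟩
    push_cast
    linarith
  have hgm : AEStronglyMeasurable g (volume.restrict S) := by
    have h1 : Measurable fun t : ℝ => ⌈t / τ⌉₊ := Nat.measurable_ceil.comp (measurable_id.div_const τ)
    exact ((StronglyMeasurable.of_discrete (f := fun k : ℕ => a (k + 1) - a k)).comp_measurable
      h1).aestronglyMeasurable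
  have hgu : eLpNorm g r (volume.restrict S) ≤ ENNReal.ofReal (C * τ) := by
    refine le_trans ?_ hshift
    have : eLpNorm g r (volume.restrict S)
        = eLpNorm (fun t => u (t + τ) - u t) r (volume.restrict S) := by
      refine eLpNorm_congr_ae ((ae_restrict_iff' measurableSet_Ioc).2 (.of_forall fun t ht => ?_))
      have ht' := hSsub ht
      simp only [hg]
      rw [hu t ⟨ht'.1, by linarith [ht'.2]⟩, hu (t + τ) ⟨by linarith [ht'.1], by linarith [ht'.2]⟩,
        ceil_shift hτ ht'.1]
    rw [this, timeMeasure_eq_Ioc]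
    exact eLpNorm_mono_measure _ (Measure.restrict_mono hSsub le_rfl)
  have hvol : volume.restrict S univ = ENNReal.ofReal (n * τ) := by
    rw [Measure.restrict_apply_univ, hS, Real.volume_Ioc]
    congr 1
    push_cast
    ring
  -- For `r = ∞`, `toReal` is 0 and `1 / 0 = 0`, so the exponent is 1, as it should be.
  have hexp : 0 ≤ 1 - 1 / r.toReal := by
    rcases eq_or_ne r ∞ with rfl | hr'
    · simp
    · have : 1 ≤ r.toReal := by
        simpa using ENNReal.toReal_mono hr' hr
      rw [sub_nonneg, div_le_one (by linarith)]
      exact this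
  have key := (eLpNorm_le_eLpNorm_mul_rpow_measure_univ hr hgm).trans
    (mul_le_mul_left hgu _)
  rw [eLpNorm_one_eq_lintegral_enorm, hg, lintegral_shift_eq_sum a hτ, hvol,
    ENNReal.ofReal_rpow_of_nonneg (by positivity) (by simpa using hexp),
    ← ENNReal.ofReal_mul (by positivity), ENNReal.ofReal_le_ofReal_iff (by positivity)] at key
  have h2 : (((i + n + 1 : ℕ) : ℝ) - (i + 1 : ℕ)) * τ = n * τ := by push_cast; ring
  rw [h2]
  rw [ENNReal.toReal_one, one_div_one] at key
  refine le_of_mul_le_mul_left (key.trans_eq ?_) hτ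
  ring

/-- The variation function of a step function whose shifted difference is `O(τ)` in `L^1`. -/
lemma exists_monotone_dominating_increments {B : Type*} [NormedAddCommGroup B] {a : ℕ → B}
    {u : ℝ → B} {τ T C : ℝ} {N : ℕ} (hτ : 0 < τ) (hT0 : 0 < T) (hT : T = N * τ) (hC : 0 ≤ C)
    (hu : ∀ t ∈ Ioc 0 T, u t = a ⌈t / τ⌉₊)
    (hshift : eLpNorm (fun t => u (t + τ) - u t) 1 (timeMeasure 0 (T - τ))
      ≤ ENNReal.ofReal (C * τ)) :
    ∃ V : ℝ → ℝ, Monotone V ∧ V 0 = 0 ∧ V T ≤ C ∧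
      ∀ s t, 0 < s → s ≤ t → t ≤ T → ‖u t - u s‖ ≤ V t - V s := by
  have hN : ⌈T / τ⌉₊ = N := by
    rw [hT, mul_div_cancel_right₀ _ hτ.ne', Nat.ceil_natCast]
  have hmono : Monotone fun t : ℝ => ⌈t / τ⌉₊ := fun s t hst =>
    Nat.ceil_mono (div_le_div_of_nonneg_right hst hτ.le)
  refine ⟨fun t => ∑ k ∈ Finset.Ico 1 ⌈t / τ⌉₊, ‖a (k + 1) - a k‖, ?_, by simp, ?_, ?_⟩
  · intro s t hst
    exact Finset.sum_le_sum_of_subset_of_nonneg (Finset.Ico_subset_Ico le_rfl (hmono hst))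
      fun _ _ _ => norm_nonneg _
  · have h1 : 1 ≤ N := hN ▸ one_le_ceil_div hτ hT0
    simpa [hN] using sum_increments_le le_rfl hτ hT hC hu hshift le_rfl h1 le_rfl
  · intro s t hs hst htT
    have hle : ⌈s / τ⌉₊ ≤ ⌈t / τ⌉₊ := hmono hst
    rw [hu t ⟨hs.trans_le hst, htT⟩, hu s ⟨hs, hst.trans htT⟩, le_sub_iff_add_le']
    beta_reduce
    rw [← Finset.sum_Ico_consecutive _ (one_le_ceil_div hτ hs) hle]
    gcongr
    rw [← dist_eq_norm, dist_comm]
    refine (dist_le_Ico_sum_dist a hle).trans_eq (Finset.sum_congr rfl fun k _ => ?_)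
    rw [dist_comm, dist_eq_norm]

/-- `max 1` extends the first value to `t = 0`. The extra `τ` is the rounding error: node indices
differ by at most `(t - s)/τ + 1`. -/
lemma norm_step_sub_le {B : Type*} [NormedAddCommGroup B] {a : ℕ → B}
    {u : ℝ → B} {τ T C : ℝ} {N : ℕ} {r : ℝ≥0∞} (hr : 1 ≤ r)
    (hexp : 0 ≤ 1 - 1 / r.toReal) (hτ : 0 < τ) (hT0 : 0 < T) (hT : T = N * τ) (hC : 0 ≤ C)
    (hu : ∀ t ∈ Ioc 0 T, u t = a ⌈t / τ⌉₊)
    (hshift : eLpNorm (fun t => u (t + τ) - u t) r (timeMeasure 0 (T - τ))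
      ≤ ENNReal.ofReal (C * τ)) {s t : ℝ} (hs : 0 ≤ s) (hst : s ≤ t) (ht : t ≤ T) :
    ‖a (max 1 ⌈t / τ⌉₊) - a (max 1 ⌈s / τ⌉₊)‖ ≤ C * (t - s + τ) ^ (1 - 1 / r.toReal) := by
  have hN : 1 ≤ N := by
    rcases Nat.eq_zero_or_pos N with rfl | h
    · simp at hT; exact absurd hT hT0.ne'
    · exact h
  have hle : max 1 ⌈s / τ⌉₊ ≤ max 1 ⌈t / τ⌉₊ :=
    max_le_max le_rfl (Nat.ceil_mono (div_le_div_of_nonneg_right hst hτ.le))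
  have hj : max 1 ⌈t / τ⌉₊ ≤ N := max_le hN (ceil_div_le hτ (hT ▸ ht))
  have h1 : ‖a (max 1 ⌈t / τ⌉₊) - a (max 1 ⌈s / τ⌉₊)‖
      ≤ ∑ k ∈ Finset.Ico (max 1 ⌈s / τ⌉₊) (max 1 ⌈t / τ⌉₊), ‖a (k + 1) - a k‖ := by
    rw [← dist_eq_norm, dist_comm]
    refine (dist_le_Ico_sum_dist a hle).trans_eq (Finset.sum_congr rfl fun k _ => ?_)
    rw [dist_comm, dist_eq_norm]
  refine h1.trans ((sum_increments_le hr hτ hT hC hu hshift (le_max_left _ _) hle hj).trans ?_)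
  have hle' : ((max 1 ⌈s / τ⌉₊ : ℕ) : ℝ) ≤ (max 1 ⌈t / τ⌉₊ : ℕ) := by exact_mod_cast hle
  have ht1 : ((max 1 ⌈t / τ⌉₊ : ℕ) : ℝ) ≤ t / τ + 1 := by
    have h0 : 0 ≤ t / τ := div_nonneg (hs.trans hst) hτ.le
    rw [Nat.cast_max]
    exact max_le (by simpa using h0) (Nat.ceil_lt_add_one h0).le
  have hs1 : s / τ ≤ ((max 1 ⌈s / τ⌉₊ : ℕ) : ℝ) :=
    (Nat.le_ceil _).trans (by exact_mod_cast le_max_right _ _)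
  have h2 : (((max 1 ⌈t / τ⌉₊ : ℕ) : ℝ) - (max 1 ⌈s / τ⌉₊ : ℕ)) * τ ≤ t - s + τ := by
    calc _ ≤ (t / τ + 1 - s / τ) * τ := by gcongr
      _ = t - s + τ := by field_simp; ring
  exact mul_le_mul_of_nonneg_left
    (Real.rpow_le_rpow (mul_nonneg (sub_nonneg.2 hle') hτ.le) h2 hexp) hC

/-! ### Finite codes and total boundedness -/

/-- A function with small `L^1` norm is somewhere bounded by (slightly more than) its mean. -/
lemma exists_norm_le_in_cell {X : Type*} [NormedAddCommGroup X] {v : ℝ → X} {T c a b : ℝ}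
    (hc : 0 ≤ c) (hab : a < b) (ha : 0 ≤ a) (hb : b ≤ T)
    (hv : eLpNorm v 1 (timeMeasure 0 T) ≤ ENNReal.ofReal c) :
    ∃ t ∈ Ioc a b, ‖v t‖ ≤ c / (b - a) + 1 := by
  by_contra! H
  have hba : 0 < b - a := sub_pos.2 hab
  have h1 : ∫⁻ _ in Ioc a b, ENNReal.ofReal (c / (b - a) + 1)
      ≤ ∫⁻ t in Ioc a b, ‖v t‖ₑ :=
    setLIntegral_mono' measurableSet_Ioc fun t ht => by
      rw [← ofReal_norm]; exact ENNReal.ofReal_le_ofReal (H t ht).le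
  have h2 : ∫⁻ t in Ioc a b, ‖v t‖ₑ ≤ ENNReal.ofReal c := by
    rw [eLpNorm_one_eq_lintegral_enorm, timeMeasure_eq_Ioc] at hv
    exact (lintegral_mono_set (Ioc_subset_Ioc ha hb)).trans hv
  have h3 := h1.trans h2
  rw [setLIntegral_const, Real.volume_Ioc, ← ENNReal.ofReal_mul (by positivity),
    ENNReal.ofReal_le_ofReal_iff hc, add_mul, div_mul_cancel₀ _ hba.ne'] at h3
  linarith

/-- On a finite grid, a family `K ∘ v n` with `v n` bounded in `L^1` and `K` compact takes, up to
`δ`, only finitely many patterns of values. -/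
lemma exists_finite_code.{x, y} {X : Type x} {B : Type y} [NormedAddCommGroup X]
    [NormedAddCommGroup B]
    {K : X → B} (hK : IsNonlinearCompact K) {v : ℕ → ℝ → X} {u : ℕ → ℝ → B} {T c h δ : ℝ} {M : ℕ}
    (huv : ∀ n, ∀ t ∈ Ioc 0 T, u n t = K (v n t)) (hc : 0 ≤ c)
    (hv : ∀ n, eLpNorm (v n) 1 (timeMeasure 0 T) ≤ ENNReal.ofReal c)
    (hh : 0 < h) (hT : T = M * h) (hδ : 0 < δ) :
    ∃ (β : Type y) (_ : Finite β) (F : ℕ → β), ∀ n m, F n = F m → ∀ j < M,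
      ∃ s ∈ Ioc ((j : ℝ) * h) (((j : ℝ) + 1) * h), ∃ t ∈ Ioc ((j : ℝ) * h) (((j : ℝ) + 1) * h),
        ‖u n s - u m t‖ ≤ δ := by
  have htb := (hK _ (Metric.isBounded_closedBall (x := (0 : X)) (r := c / h + 1))).totallyBounded
  obtain ⟨A, hA, hcov⟩ := Metric.totallyBounded_iff.1 htb (δ / 2) (half_pos hδ)
  have key : ∀ n (j : Fin M), ∃ y : A, ∃ t ∈ Ioc ((j : ℝ) * h) (((j : ℝ) + 1) * h),
      dist (u n t) y < δ / 2 := by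
    intro n j
    have hjM : ((j : ℝ) + 1) * h ≤ T := by
      rw [hT]
      have : ((j : ℕ) : ℝ) + 1 ≤ M := by exact_mod_cast j.2
      gcongr
    obtain ⟨t, ht, hvt⟩ := exists_norm_le_in_cell (a := (j : ℝ) * h) (b := ((j : ℝ) + 1) * h) hc
      (by nlinarith) (by positivity) hjM (hv n)
    rw [show ((j : ℝ) + 1) * h - j * h = h by ring] at hvt
    have htT : t ∈ Ioc 0 T := ⟨lt_of_le_of_lt (by positivity) ht.1, ht.2.trans hjM⟩
    have hmem : u n t ∈ closure (K '' Metric.closedBall 0 (c / h + 1)) := by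
      rw [huv n t htT]
      exact subset_closure ⟨_, by simpa using hvt, rfl⟩
    obtain ⟨y, hy, hty⟩ := mem_iUnion₂.1 (hcov hmem)
    exact ⟨⟨y, hy⟩, t, ht, hty⟩
  choose F t ht hF using key
  have := hA.to_subtype
  refine ⟨Fin M → A, inferInstance, F, fun n m hnm j hj => ⟨_, ht n ⟨j, hj⟩, _, ht m ⟨j, hj⟩, ?_⟩⟩
  rw [← dist_eq_norm]
  have h1 := hF n ⟨j, hj⟩
  have h2 := hF m ⟨j, hj⟩
  rw [hnm] at h1
  linarith [dist_triangle_right (u n (t n ⟨j, hj⟩)) (u m (t m ⟨j, hj⟩)) (F m ⟨j, hj⟩ : B)]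

lemma totallyBounded_range_of_finite_code.{y} {E : Type*} [PseudoEMetricSpace E] {f : ℕ → E}
    (H : ∀ ε > 0, ∃ n₀ : ℕ, ∃ (β : Type y) (_ : Finite β) (F : ℕ → β),
      ∀ n ≥ n₀, ∀ m ≥ n₀, F n = F m → edist (f n) (f m) < ε) :
    TotallyBounded (range f) := by
  refine EMetric.totallyBounded_iff.2 fun ε hε => ?_
  obtain ⟨n₀, β, _, F, hF⟩ := H ε hε
  classical
  -- One late representative per code; together with the early terms these form the net. The default
  -- 0 is harmless.
  let g : β → ℕ := fun b => if h : ∃ n ≥ n₀, F n = b then h.choose else 0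
  refine ⟨f '' (Iio n₀ ∪ range g), ((finite_Iio _).union (finite_range g)).image f, ?_⟩
  rintro _ ⟨n, rfl⟩
  rw [mem_iUnion₂]
  rcases lt_or_ge n n₀ with hn | hn
  · exact ⟨f n, ⟨n, .inl hn, rfl⟩, Metric.mem_eball_self hε⟩
  · have hex : ∃ m ≥ n₀, F m = F n := ⟨n, hn, rfl⟩
    refine ⟨f (g (F n)), ⟨_, .inr ⟨_, rfl⟩, rfl⟩, ?_⟩
    have hg : g (F n) = hex.choose := dif_pos hex
    rw [hg]
    exact hF n hn _ hex.choose_spec.1 hex.choose_spec.2.symm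

/-! ### The case `p < ∞` -/

/-- An `L^p` bound from bounds on the cells of a uniform grid. -/
lemma eLpNorm_le_of_cells {B : Type*} [NormedAddCommGroup B] {f : ℝ → B} {W : ℕ → ℝ}
    {A S T h : ℝ} {M : ℕ} {p : ℝ≥0∞} (hp : 1 ≤ p) (hp' : p ≠ ∞) (hh : 0 < h) (hT : T = M * h)
    (hA : 0 ≤ A) (hS : 0 ≤ S)
    (hW0 : ∀ j < M, 0 ≤ W j) (hWA : ∀ j < M, W j ≤ A) (hsum : ∑ j ∈ Finset.range M, W j ≤ S)
    (hf : ∀ j < M, ∀ x ∈ Ioc ((j : ℝ) * h) (((j : ℝ) + 1) * h), ‖f x‖ ≤ W j) :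
    eLpNorm f p (timeMeasure 0 T)
      ≤ ENNReal.ofReal ((A ^ (p.toReal - 1) * (S * h)) ^ (1 / p.toReal)) := by
  have hp1 : 1 ≤ p.toReal := by simpa using ENNReal.toReal_mono hp' hp
  rw [eLpNorm_eq_lintegral_rpow_enorm_toReal (by positivity) hp', timeMeasure_eq_Ioc,
    ← ENNReal.ofReal_rpow_of_nonneg (by positivity) (by positivity)]
  refine ENNReal.rpow_le_rpow ?_ (by positivity)
  -- Interpolation between sup and sum: `W j ^ p ≤ A ^ (p - 1) * W j`.
  have hcell : ∀ j ∈ Finset.range M,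
      ∫⁻ x in Ioc ((j : ℝ) * h) (((j : ℝ) + 1) * h), ‖f x‖ₑ ^ p.toReal
        ≤ ENNReal.ofReal (A ^ (p.toReal - 1) * (W j * h)) := by
    intro j hj
    rw [Finset.mem_range] at hj
    calc _ ≤ ∫⁻ _ in Ioc ((j : ℝ) * h) (((j : ℝ) + 1) * h),
          ENNReal.ofReal (A ^ (p.toReal - 1) * W j) := by
          refine setLIntegral_mono' measurableSet_Ioc fun x hx => ?_
          rw [← ofReal_norm, ENNReal.ofReal_rpow_of_nonneg (norm_nonneg _) (by positivity)]
          refine ENNReal.ofReal_le_ofReal ?_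
          calc ‖f x‖ ^ p.toReal ≤ W j ^ p.toReal :=
                Real.rpow_le_rpow (norm_nonneg _) (hf j hj x hx) (by positivity)
            _ = W j ^ (p.toReal - 1) * W j := by
                conv_lhs => rw [← sub_add_cancel p.toReal 1]
                rw [Real.rpow_add_of_nonneg (hW0 j hj) (by linarith) zero_le_one, Real.rpow_one]
            _ ≤ A ^ (p.toReal - 1) * W j := by
                exact mul_le_mul_of_nonneg_right
                  (Real.rpow_le_rpow (hW0 j hj) (hWA j hj) (by linarith)) (hW0 j hj)
      _ = _ := by
          rw [setLIntegral_const, Real.volume_Ioc,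
            ← ENNReal.ofReal_mul (mul_nonneg (by positivity) (hW0 j hj))]
          congr 1
          ring
  have hcover : Ioc 0 T ⊆ ⋃ j : Fin M, Ioc ((j : ℝ) * h) (((j : ℝ) + 1) * h) := by
    intro t ht
    obtain ⟨j, hj, htj⟩ := exists_cell hh ht.1 (hT ▸ ht.2)
    exact mem_iUnion.2 ⟨⟨j, hj⟩, htj⟩
  calc _ ≤ ∫⁻ x in ⋃ j : Fin M, Ioc ((j : ℝ) * h) (((j : ℝ) + 1) * h),
        ‖f x‖ₑ ^ p.toReal := lintegral_mono_set hcover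
    _ ≤ ∑ j ∈ Finset.range M, ∫⁻ x in Ioc ((j : ℝ) * h) (((j : ℝ) + 1) * h),
        ‖f x‖ₑ ^ p.toReal := by
        rw [Finset.sum_range]
        exact (lintegral_iUnion_le _ _).trans_eq (tsum_fintype _)
    _ ≤ ∑ j ∈ Finset.range M, ENNReal.ofReal (A ^ (p.toReal - 1) * (W j * h)) :=
        Finset.sum_le_sum hcell
    _ = ENNReal.ofReal (∑ j ∈ Finset.range M, A ^ (p.toReal - 1) * (W j * h)) :=
        (ENNReal.ofReal_sum_of_nonneg fun j hj =>
          mul_nonneg (by positivity)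
            (mul_nonneg (hW0 j (Finset.mem_range.1 hj)) hh.le)).symm
    _ ≤ _ := by
        refine ENNReal.ofReal_le_ofReal ?_
        rw [← Finset.mul_sum, ← Finset.sum_mul]
        gcongr

/-- Two functions of bounded variation which nearly agree somewhere in each cell of a grid are
close in `L^p`. -/
lemma eLpNorm_sub_le_of_variation {B : Type*} [NormedAddCommGroup B] {f g : ℝ → B} {V W : ℝ → ℝ}
    {C T h δ : ℝ} {M : ℕ} {p : ℝ≥0∞} (hp : 1 ≤ p) (hp' : p ≠ ∞) (hh : 0 < h) (hT : T = M * h)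
    (hδ : 0 ≤ δ) (hV : Monotone V) (hW : Monotone W) (hV0 : V 0 = 0) (hW0 : W 0 = 0)
    (hVT : V T ≤ C) (hWT : W T ≤ C)
    (hfV : ∀ s t, 0 < s → s ≤ t → t ≤ T → ‖f t - f s‖ ≤ V t - V s)
    (hgW : ∀ s t, 0 < s → s ≤ t → t ≤ T → ‖g t - g s‖ ≤ W t - W s)
    (hfg : ∀ j < M, ∃ s ∈ Ioc ((j : ℝ) * h) (((j : ℝ) + 1) * h),
      ∃ t ∈ Ioc ((j : ℝ) * h) (((j : ℝ) + 1) * h), ‖f s - g t‖ ≤ δ) :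
    eLpNorm (fun t => f t - g t) p (timeMeasure 0 T) ≤ ENNReal.ofReal
      (((2 * C + δ) ^ (p.toReal - 1) * ((2 * C + M * δ) * h)) ^ (1 / p.toReal)) := by
  have hT0 : 0 ≤ T := by rw [hT]; positivity
  have hC : 0 ≤ C := by linarith [hV hT0]
  have hcell : ∀ j < M, ((j : ℝ) + 1) * h ≤ T := fun j hj => by
    rw [hT]
    have : (j : ℝ) + 1 ≤ M := by exact_mod_cast hj
    gcongr
  have hosc : ∀ (φ : ℝ → B) (U : ℝ → ℝ), Monotone U →
      (∀ s t, 0 < s → s ≤ t → t ≤ T → ‖φ t - φ s‖ ≤ U t - U s) → ∀ j < M,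
      ∀ x ∈ Ioc ((j : ℝ) * h) (((j : ℝ) + 1) * h), ∀ y ∈ Ioc ((j : ℝ) * h) (((j : ℝ) + 1) * h),
        ‖φ x - φ y‖ ≤ U ((j + 1) * h) - U (j * h) := by
    intro φ U hU hφ j hj
    have hlt : ∀ x ∈ Ioc ((j : ℝ) * h) (((j : ℝ) + 1) * h), 0 < x := fun x hx =>
      lt_of_le_of_lt (by positivity) hx.1
    have hmain : ∀ x ∈ Ioc ((j : ℝ) * h) (((j : ℝ) + 1) * h),
        ∀ y ∈ Ioc ((j : ℝ) * h) (((j : ℝ) + 1) * h), x ≤ y →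
        ‖φ y - φ x‖ ≤ U ((j + 1) * h) - U (j * h) := fun x hx y hy hxy => by
      linarith [hφ x y (hlt x hx) hxy (hy.2.trans (hcell j hj)), hU hy.2, hU hx.1.le]
    intro x hx y hy
    rcases le_total x y with hxy | hxy
    · rw [norm_sub_rev]; exact hmain x hx y hy hxy
    · exact hmain y hy x hx hxy
  have hVj : ∀ j : ℕ, V (j * h) ≤ V ((j + 1) * h) := fun j => hV (by nlinarith)
  have hWj : ∀ j : ℕ, W (j * h) ≤ W ((j + 1) * h) := fun j => hW (by nlinarith)
  have hpos : ∀ j : ℕ, 0 ≤ (j : ℝ) * h := fun j => by positivity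
  refine eLpNorm_le_of_cells (W := fun j =>
    (V ((j + 1) * h) - V (j * h)) + (W ((j + 1) * h) - W (j * h)) + δ)
    hp hp' hh hT (by positivity) (by positivity) ?_ ?_ ?_ ?_
  · intro j _
    linarith [hVj j, hWj j]
  · intro j hj
    linarith [hV (hcell j hj), hW (hcell j hj), hV (hpos j), hW (hpos j)]
  · have htel : ∀ U : ℝ → ℝ, ∑ j ∈ Finset.range M, (U (((j : ℝ) + 1) * h) - U (j * h))
        = U T - U 0 := fun U => by
      have := Finset.sum_range_sub (fun j : ℕ => U (j * h)) M
      push_cast at this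
      rw [this, hT, zero_mul]
    rw [Finset.sum_add_distrib, Finset.sum_add_distrib, htel V, htel W, Finset.sum_const,
      Finset.card_range, nsmul_eq_mul]
    linarith
  · intro j hj x hx
    obtain ⟨s, hs, t, ht, hst⟩ := hfg j hj
    have h1 := hosc f V hV hfV j hj x hx s hs
    have h2 := hosc g W hW hgW j hj t ht x hx
    calc ‖f x - g x‖ = ‖(f x - f s) + (g t - g x) + (f s - g t)‖ := by congr 1; abel
      _ ≤ _ := norm_add₃_le.trans (by linarith)

theorem totallyBounded_range_toLp_of_variation {X B : Type*} [NormedAddCommGroup X]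
    [NormedAddCommGroup B] {K : X → B} (hK : IsNonlinearCompact K) {v : ℕ → ℝ → X} {u : ℕ → ℝ → B}
    {p : ℝ≥0∞} [hp : Fact (1 ≤ p)] (hp' : p ≠ ∞) {T c C : ℝ} (hT : 0 < T)
    (huv : ∀ n, ∀ t ∈ Ioc 0 T, u n t = K (v n t)) (hc : 0 ≤ c)
    (hv : ∀ n, eLpNorm (v n) 1 (timeMeasure 0 T) ≤ ENNReal.ofReal c)
    (hu : ∀ n, MemLp (u n) p (timeMeasure 0 T))
    (hvar : ∀ n, ∃ V : ℝ → ℝ, Monotone V ∧ V 0 = 0 ∧ V T ≤ C ∧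
      ∀ s t, 0 < s → s ≤ t → t ≤ T → ‖u n t - u n s‖ ≤ V t - V s) :
    TotallyBounded (range fun n => (hu n).toLp (u n)) := by
  refine totallyBounded_range_of_finite_code fun ε hε => ?_
  -- The bound of `eLpNorm_sub_le_of_variation` with `x = δ = 1/M` and `h = T/M`, so that `M * δ =
  -- 1`.
  have hlim : Tendsto (fun x : ℝ => ENNReal.ofReal
      (((2 * C + x) ^ (p.toReal - 1) * ((2 * C + 1) * T * x)) ^ (1 / p.toReal))) (𝓝 0) (𝓝 0) := by
    have hp1 : 1 ≤ p.toReal := by simpa using ENNReal.toReal_mono hp' hp.out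
    have hcont : ContinuousAt (fun x : ℝ => ENNReal.ofReal
        (((2 * C + x) ^ (p.toReal - 1) * ((2 * C + 1) * T * x)) ^ (1 / p.toReal))) 0 := by
      refine ENNReal.continuous_ofReal.continuousAt.comp (ContinuousAt.rpow_const
        (ContinuousAt.mul (ContinuousAt.rpow_const (by fun_prop) (.inr (by linarith)))
          (by fun_prop)) (.inr (by positivity)))
    have h0 : (1 : ℝ) / p.toReal ≠ 0 := by positivity
    have h1 := hcont.tendsto
    rwa [mul_zero, mul_zero, Real.zero_rpow h0, ENNReal.ofReal_zero] at h1
  obtain ⟨M, hM, hM0⟩ := (((hlim.comp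
    (tendsto_inv_atTop_nhds_zero_nat (𝕜 := ℝ))).eventually_lt_const hε).and
      (eventually_gt_atTop 0)).exists
  have hM' : (0 : ℝ) < M := by exact_mod_cast hM0
  obtain ⟨β, hβ, F, hF⟩ := exists_finite_code hK huv hc hv (h := T / M) (δ := (M : ℝ)⁻¹) (M := M)
    (by positivity) (by field_simp) (by positivity)
  refine ⟨0, β, hβ, F, fun n _ m _ hnm => ?_⟩
  obtain ⟨V, hV, hV0, hVT, hVu⟩ := hvar n
  obtain ⟨W, hW, hW0, hWT, hWu⟩ := hvar m
  rw [Lp.edist_toLp_toLp]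
  refine lt_of_le_of_lt (eLpNorm_sub_le_of_variation hp.out hp' (h := T / M) (by positivity)
    (by field_simp) (by positivity) hV hW hV0 hW0 hVT hWT hVu hWu (hF n m hnm)) ?_
  have harg : (2 * C + (M : ℝ) * (M : ℝ)⁻¹) * (T / M) = (2 * C + 1) * T * (M : ℝ)⁻¹ := by
    field_simp
  rw [harg]
  exact hM

/-! ### The case `p = ∞` -/

/-- An asymptotically equicontinuous family with finitely many patterns up to `δ` on every grid
is totally bounded for uniform convergence. -/
theorem totallyBounded_range_uniformFun.{y} {B : Type y} [NormedAddCommGroup B] {T : ℝ}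
    (hT : 0 < T) {f : ℕ → ℝ → B}
    (hequi : ∀ ε > 0, ∃ η > 0, ∃ n₀ : ℕ, ∀ n ≥ n₀, ∀ s ∈ Icc 0 T, ∀ t ∈ Icc 0 T,
      |t - s| ≤ η → ‖f n t - f n s‖ ≤ ε)
    (hcode : ∀ (M : ℕ) (h δ : ℝ), 0 < h → T = M * h → 0 < δ →
      ∃ (β : Type y) (_ : Finite β) (F : ℕ → β), ∀ n m, F n = F m → ∀ j < M,
        ∃ s ∈ Ioc ((j : ℝ) * h) (((j : ℝ) + 1) * h),
        ∃ t ∈ Ioc ((j : ℝ) * h) (((j : ℝ) + 1) * h), ‖f n s - f m t‖ ≤ δ) :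
    TotallyBounded (range fun n => UniformFun.ofFun fun t : Icc 0 T => f n t) := by
  refine totallyBounded_range_of_finite_code fun ε hε => ?_
  -- One `e` for each of the two oscillations, one for the mismatch of the codes.
  obtain ⟨e, he, heε⟩ : ∃ e : ℝ, 0 < e ∧ ENNReal.ofReal (3 * e) < ε := by
    obtain ⟨x, hx, hxε⟩ := ENNReal.lt_iff_exists_real_btwn.1 hε
    refine ⟨x / 3, ?_, by rw [mul_div_cancel₀ _ (three_ne_zero)]; exact hxε.2⟩
    have := ENNReal.ofReal_pos.1 hxε.1
    linarith
  obtain ⟨η, hη, n₀, hn₀⟩ := hequi e he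
  obtain ⟨M, hM⟩ := exists_nat_gt (T / η)
  have hM' : (0 : ℝ) < M := (div_pos hT hη).trans hM
  have hhη : T / M ≤ η := by
    rw [div_le_iff₀ hM', ← div_le_iff₀' hη]
    exact hM.le
  have hMh : T = M * (T / M) := by field_simp
  obtain ⟨β, hβ, F, hF⟩ := hcode M (T / M) e (by positivity) hMh he
  refine ⟨n₀, β, hβ, F, fun n hn m hm hnm => lt_of_le_of_lt (UniformFun.edist_le.2 ?_) heε⟩
  rintro ⟨x, hx⟩
  -- Closed cells, since `x = 0` lies in no half-open one.
  obtain ⟨j, hj, hxj⟩ : ∃ j < M, x ∈ Icc ((j : ℝ) * (T / M)) (((j : ℝ) + 1) * (T / M)) := by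
    rcases hx.1.eq_or_lt with rfl | h0
    · exact ⟨0, by exact_mod_cast hM', by simp; positivity⟩
    · obtain ⟨j, hj, hxj⟩ := exists_cell (by positivity) h0 (hx.2.trans_eq hMh)
      exact ⟨j, hj, Ioc_subset_Icc_self hxj⟩
  have hcell : ∀ y ∈ Icc ((j : ℝ) * (T / M)) (((j : ℝ) + 1) * (T / M)),
      y ∈ Icc 0 T ∧ |x - y| ≤ η ∧ |y - x| ≤ η := fun y hy => by
    have h1 : ((j : ℝ) + 1) * (T / M) ≤ T := by
      conv_rhs => rw [hMh]
      have : (j : ℝ) + 1 ≤ M := by exact_mod_cast hj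
      gcongr
    have h2 : |x - y| ≤ η := by
      rw [abs_le]
      constructor <;> linarith [hxj.1, hxj.2, hy.1, hy.2]
    exact ⟨⟨le_trans (by positivity) hy.1, hy.2.trans h1⟩, h2, abs_sub_comm x y ▸ h2⟩
  obtain ⟨s, hs, t, ht, hst⟩ := hF n m hnm j hj
  obtain ⟨hs, hs', -⟩ := hcell s (Ioc_subset_Icc_self hs)
  obtain ⟨ht, -, ht'⟩ := hcell t (Ioc_subset_Icc_self ht)
  have h1 := hn₀ n hn s hs x hx hs'
  have h2 := hn₀ m hm x hx t ht ht'
  simp only [UniformFun.toFun_ofFun]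
  rw [edist_eq_enorm_sub, ← ofReal_norm]
  refine ENNReal.ofReal_le_ofReal ?_
  calc ‖f n x - f m x‖ = ‖(f n x - f n s) + (f m t - f m x) + (f n s - f m t)‖ := by
        congr 1; abel
    _ ≤ _ := norm_add₃_le.trans (by linarith)

/-- The `f n` may jump: the inequality is needed only for large `n`, and pointwise convergence
carries it to `w`. -/
lemma continuousOn_of_tendstoUniformly_asymptotic {B : Type*} [NormedAddCommGroup B] {S : Set ℝ}
    {f : ℕ → ℝ → B} {w : ℝ → B}
    (hequi : ∀ ε > 0, ∃ η > 0, ∃ n₀ : ℕ, ∀ n ≥ n₀, ∀ s ∈ S, ∀ t ∈ S,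
      |t - s| ≤ η → ‖f n t - f n s‖ ≤ ε)
    (hw : ∀ t ∈ S, Tendsto (fun n => f n t) atTop (𝓝 (w t))) : ContinuousOn w S := by
  rw [Metric.continuousOn_iff]
  intro s hs ε hε
  obtain ⟨η, hη, n₀, h⟩ := hequi (ε / 2) (half_pos hε)
  refine ⟨η, hη, fun t ht hts => ?_⟩
  rw [Real.dist_eq] at hts
  have hlim := ((hw t ht).sub (hw s hs)).norm
  rw [dist_eq_norm]
  refine lt_of_le_of_lt (le_of_tendsto hlim ?_) (half_lt_self hε)
  filter_upwards [eventually_ge_atTop n₀] with n hn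
  exact h n hn s hs t ht hts.le

lemma tendsto_eLpNorm_of_tendstoUniformlyOn {B : Type*} [NormedAddCommGroup B] {T : ℝ}
    {f : ℕ → ℝ → B} {w : ℝ → B} (h : TendstoUniformlyOn f w atTop (Ioc 0 T)) (q : ℝ≥0∞) :
    Tendsto (fun n => eLpNorm (fun t => f n t - w t) q (timeMeasure 0 T)) atTop (𝓝 0) := by
  set c := timeMeasure 0 T univ ^ q.toReal⁻¹ with hc
  have hctop : c ≠ ∞ := by
    refine ENNReal.rpow_ne_top_of_nonneg (by positivity) ?_
    simp [timeMeasure]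
  have hlim : Tendsto (fun x : ℝ => c * ENNReal.ofReal x) (𝓝[>] 0) (𝓝 0) := by
    have : Tendsto (fun x : ℝ => c * ENNReal.ofReal x) (𝓝 0) (𝓝 (c * ENNReal.ofReal 0)) :=
      ENNReal.Tendsto.const_mul (ENNReal.continuous_ofReal.tendsto 0) (.inr hctop)
    simpa using this.mono_left nhdsWithin_le_nhds
  refine ENNReal.tendsto_nhds_zero.2 fun ε hε => ?_
  obtain ⟨x, hx, hx0⟩ := ((hlim.eventually_lt_const hε).and self_mem_nhdsWithin).exists
  filter_upwards [Metric.tendstoUniformlyOn_iff.1 h x hx0] with n hn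
  refine (eLpNorm_le_of_ae_bound ?_).trans hx.le
  rw [timeMeasure_eq_Ioc]
  refine (ae_restrict_iff' measurableSet_Ioc).2 (.of_forall fun t ht => ?_)
  rw [← dist_eq_norm, dist_comm]
  exact (hn t ht).le

/-- Step functions with vanishing time step whose shifted differences are `O(τ)` in `L^r`, `1 < r`,
are asymptotically equicontinuous. -/
lemma asymptotic_equicontinuity {B : Type*} [NormedAddCommGroup B] {a : ℕ → ℕ → B}
    {u : ℕ → ℝ → B} {τ : ℕ → ℝ} {T C : ℝ} {N : ℕ → ℕ} {r : ℝ≥0∞} (hr : 1 < r)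
    (hτ : ∀ n, 0 < τ n) (hT0 : 0 < T) (hT : ∀ n, T = N n * τ n) (hC : 0 ≤ C)
    (hu : ∀ n, ∀ t ∈ Ioc 0 T, u n t = a n ⌈t / τ n⌉₊)
    (hshift : ∀ n, eLpNorm (fun t => u n (t + τ n) - u n t) r (timeMeasure 0 (T - τ n))
      ≤ ENNReal.ofReal (C * τ n)) (hlim : Tendsto τ atTop (𝓝 0)) :
    ∀ ε > 0, ∃ η > 0, ∃ n₀ : ℕ, ∀ n ≥ n₀, ∀ s ∈ Icc 0 T, ∀ t ∈ Icc 0 T, |t - s| ≤ η →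
      ‖a n (max 1 ⌈t / τ n⌉₊) - a n (max 1 ⌈s / τ n⌉₊)‖ ≤ ε := by
  intro ε hε
  have hexp : 0 < 1 - 1 / r.toReal := by
    rcases eq_or_ne r ∞ with rfl | hr'
    · simp
    · have h1 : 1 < r.toReal := by
        simpa using (ENNReal.toReal_lt_toReal ENNReal.one_ne_top hr').2 hr
      rw [sub_pos, div_lt_one (by linarith)]
      exact h1
  have hc : Tendsto (fun x : ℝ => C * x ^ (1 - 1 / r.toReal)) (𝓝[>] 0) (𝓝 0) := by
    have h1 : ContinuousAt (fun x : ℝ => C * x ^ (1 - 1 / r.toReal)) 0 :=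
      continuousAt_const.mul (continuousAt_id.rpow_const (.inr hexp.le))
    have h2 := h1.tendsto
    rw [Real.zero_rpow hexp.ne', mul_zero] at h2
    exact h2.mono_left nhdsWithin_le_nhds
  obtain ⟨ρ, hρ, hρ0⟩ := ((hc.eventually_lt_const hε).and self_mem_nhdsWithin).exists
  have hρ0 : 0 < ρ := hρ0
  obtain ⟨n₀, hn₀⟩ := eventually_atTop.1 (hlim.eventually_lt_const (half_pos hρ0))
  have hmain : ∀ n ≥ n₀, ∀ s ∈ Icc 0 T, ∀ t ∈ Icc 0 T, |t - s| ≤ ρ / 2 → s ≤ t →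
      ‖a n (max 1 ⌈t / τ n⌉₊) - a n (max 1 ⌈s / τ n⌉₊)‖ ≤ ε := by
    intro n hn s hs t ht hts hst
    refine (norm_step_sub_le hr.le hexp.le (hτ n) hT0 (hT n) hC (hu n) (hshift n) hs.1 hst
      ht.2).trans (le_trans ?_ hρ.le)
    refine mul_le_mul_of_nonneg_left (Real.rpow_le_rpow ?_ ?_ hexp.le) hC
    · linarith [hτ n]
    · linarith [hn₀ n hn, le_abs_self (t - s)]
  refine ⟨ρ / 2, half_pos hρ0, n₀, fun n hn s hs t ht hts => ?_⟩
  rcases le_total s t with hst | hst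
  · exact hmain n hn s hs t ht hts hst
  · rw [norm_sub_rev]
    exact hmain n hn t ht s hs (abs_sub_comm t s ▸ hts) hst

theorem mainTheorem5
    {X B : Type*} [NormedAddCommGroup X] [NormedSpace ℝ X] [CompleteSpace X]
    [NormedAddCommGroup B] [NormedSpace ℝ B] [CompleteSpace B]
    (p r : ℝ≥0∞) [Fact (1 ≤ p)]
    (hpr : (p < ∞ ∧ r = 1) ∨ (p = ∞ ∧ 1 < r))
    (T : ℝ) (hT : 0 < T)
    (K : X → B) (hK : IsNonlinearCompact K)
    (τ : ℕ → ℝ) (N : ℕ → ℕ) (hτ : ∀ n, 0 < τ n) (hN : ∀ n, T = (N n : ℝ) * τ n)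
    (v : ℕ → ℝ → X) (u : ℕ → ℝ → B)
    (hv : ∀ n, MemLp (v n) 1 (timeMeasure 0 T))
    (hvconst : ∀ n, IsPiecewiseConstInTime (τ n) (N n) (v n))
    (huv : ∀ n, ∀ t ∈ Ioc 0 T, u n t = K (v n t))
    (hu : ∀ n, MemLp (u n) p (timeMeasure 0 T))
    (hvbdd : ∃ C : ℝ, ∀ n, eLpNorm (v n) 1 (timeMeasure 0 T) ≤ ENNReal.ofReal C)
    (hubdd : ∃ C : ℝ, ∀ n, eLpNorm (u n) 1 (timeMeasure 0 T) ≤ ENNReal.ofReal C)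
    (hshift : ∃ C : ℝ, 0 < C ∧ ∀ n,
      eLpNorm (fun t => u n (t + τ n) - u n t) r (timeMeasure 0 (T - τ n))
        ≤ ENNReal.ofReal (C * τ n)) :
    (p < ∞ →
      IsCompact (closure (Set.range fun n : ℕ =>
        ((hu n).toLp (u n) : Lp B p (timeMeasure 0 T))))) ∧
    (p = ∞ → Tendsto τ atTop (𝓝 0) →
      ∃ φ : ℕ → ℕ, StrictMono φ ∧ ∃ w : ℝ → B, ContinuousOn w (Icc 0 T) ∧
        ∀ q : ℝ≥0∞, 1 ≤ q → q < ∞ →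
          Tendsto (fun n => eLpNorm (fun t => u (φ n) t - w t) q (timeMeasure 0 T))
            atTop (𝓝 0)) := by
  obtain ⟨c, hc⟩ := hvbdd
  obtain ⟨C, hC, hshift⟩ := hshift
  have hv' : ∀ n, eLpNorm (v n) 1 (timeMeasure 0 T) ≤ ENNReal.ofReal (max c 0) := fun n =>
    (hc n).trans (ENNReal.ofReal_le_ofReal (le_max_left _ _))
  obtain ⟨a, ha⟩ : ∃ a : ℕ → ℕ → B, ∀ n, ∀ t ∈ Ioc 0 T, u n t = a n ⌈t / τ n⌉₊ := by
    refine ⟨fun n k => K (v n (k * τ n)), fun n t ht => ?_⟩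
    rw [huv n t ht, (hvconst n).eq_nodal (hτ n) (hN n ▸ ht)]
  refine ⟨fun hp => ?_, fun hp hlim => ?_⟩
  · obtain rfl : r = 1 := by
      rcases hpr with h | h
      · exact h.2
      · exact absurd h.1 hp.ne
    exact (totallyBounded_range_toLp_of_variation hK hp.ne hT huv (le_max_right _ _) hv' hu
      fun n => exists_monotone_dominating_increments (hτ n) hT (hN n) hC.le (ha n)
        (hshift n)).closure.isCompact_of_isClosed isClosed_closure
  · have hr : 1 < r := by
      rcases hpr with h | h
      · exact absurd hp h.1.ne
      · exact h.2
    -- Nothing is known about `u n 0`; `f n` replaces it by the first nodal value, giving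
    -- equicontinuity up to `t = 0`.
    set f : ℕ → ℝ → B := fun n t => a n (max 1 ⌈t / τ n⌉₊) with hf
    have hfu : ∀ n, ∀ t ∈ Ioc 0 T, f n t = u n t := fun n t ht => by
      rw [ha n t ht, hf]
      simp only [max_eq_right (one_le_ceil_div (hτ n) ht.1)]
    have hequi := asymptotic_equicontinuity hr hτ hT hN hC.le ha hshift hlim
    have htb := totallyBounded_range_uniformFun hT (f := f) hequi fun M h δ hh hTM hδ =>
      exists_finite_code hK (fun n t ht => (hfu n t ht).trans (huv n t ht)) (le_max_right _ _) hv'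
        hh hTM hδ
    obtain ⟨w, -, φ, hφ, hw⟩ := (htb.closure.isCompact_of_isClosed isClosed_closure).tendsto_subseq
      (x := fun n => UniformFun.ofFun fun t : Icc 0 T => f n t)
      fun n => subset_closure (mem_range_self n)
    rw [UniformFun.tendsto_iff_tendstoUniformly] at hw
    set w' : ℝ → B := fun t => UniformFun.toFun w (projIcc 0 T hT.le t) with hw'
    have hunif : TendstoUniformlyOn (fun n t => f (φ n) t) w' atTop (Icc 0 T) := by
      rw [Metric.tendstoUniformlyOn_iff]
      intro ε hε
      filter_upwards [Metric.tendstoUniformly_iff.1 hw ε hε] with n hn t ht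
      rw [hw']
      simp only [projIcc_of_mem hT.le ht]
      exact hn ⟨t, ht⟩
    refine ⟨φ, hφ, w', ?_, fun q _ _ => ?_⟩
    · refine continuousOn_of_tendstoUniformly_asymptotic (f := fun n => f (φ n))
        (fun ε hε => ?_) fun t ht => hunif.tendsto_at ht
      obtain ⟨η, hη, n₀, h⟩ := hequi ε hε
      exact ⟨η, hη, n₀, fun n hn => h (φ n) (hn.trans (hφ.id_le n))⟩
    · refine tendsto_eLpNorm_of_tendstoUniformlyOn ?_ q
      refine (hunif.mono Ioc_subset_Icc_self).congr (.of_forall fun n t ht => ?_)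
      exact hfu (φ n) t ht
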